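/- Let $q\ge 2$ and $m\ge 0$ be integers. A subcube of $\mathbf Z_q^n$ of codimension $m$ (dimension $n-m$) is a subset obtained by fixing the values of exactly $m$ of the $n$ components and letting each of the other components run through all of $\mathbf Z_q$. An (unordered) partition of $\mathbf Z_q^n$ into $q^m$ subcubes of codimension $m$ is called A-primitive if every component is fixed in at least one of its subcubes. Its star matrix is the $q^m\times n$ matrix over $\mathbf Z_q\cup\{*\}$, determined up to the order of its rows, whose rows correspond to the subcubes: in the row of a subcube the fixed components carry their values and the free components carry $*$. The matrices $M_{q,m}$ are defined recursively: $M_{q,0}$ has one row and no columns; $M_{q,m}$ consists of $q$ horizontal stripes, numbered by $a\in\mathbf Z_q$, where every row of stripe $a$ has $a$ in the leftmost column, followed by $q$ blocks numbered by $b\in\mathbf Z_q$, the block $b=a$ being $M_{q,m-1}$ and every block $b\ne a$ being the matrix of the same size consisting only of stars. A matrix is called fractal (with parameters $q,m$) if it is obtained from $M_{q,m}$ by permuting rows and columns. Let $N^{\rm coord}_q(m)$ be the smallest natural number $N\ge 0$ such that for $n>N$ there are no A-primitive partitions of $\mathbf Z_q^n$ into $q^m$ subcubes of codimension $m$, and let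 $c^{\rm coord*}_q(n,m)$ be the number of different unordered A-primitive partitions of $\mathbf Z_q^n$ into $q^m$ subcubes of codimension $m$. Theorem. The number $N^{\rm coord}_q(m)$ exists, it is the largest $n$ for which an A-primitive partition of $\mathbf Z_q^n$ into $q^m$ subcubes of codimension $m$ exists, and $$N^{\rm coord}_q(m)=\frac{q^m-1}{q-1},\qquad c^{\rm coord*}_q\left(\frac{q^m-1}{q-1},m\right)=\left(\frac{q^m-1}{q-1}\right)!.$$ Moreover, for $n=\frac{q^m-1}{q-1}$, a family of subsets of $\mathbf Z_q^n$ is an A-primitive partition of $\mathbf Z_q^n$ into $q^m$ subcubes of codimension $m$ if and only if it is the family of subcubes given by the rows of a fractal matrix with parameters $q,m$. -/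

import Mathlib

/-- A star pattern of length `n`: a vector over `ZMod q` together with the symbol `*`,
where `some a` is the number `a` and `none` is the star. -/
abbrev StarPattern (q n : ℕ) : Type := Fin n → Option (ZMod q)

/-- The subcube of `(ZMod q)^n` with star pattern `p`: component `i` is fixed to `a` when
`p i = some a`, and free when `p i = none`. -/
def StarPattern.cube {q n : ℕ} (p : StarPattern q n) : Set (Fin n → ZMod q) :=
  {x | ∀ i a, p i = some a → x i = a}

/-- `C` is a subcube of `(ZMod q)^n` of codimension `m` (that is, of dimension `n - m`, and
`m ≤ n`): exactly `m` components are fixed, all the others run through all of `ZMod q`. -/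
def IsSubcube (q n m : ℕ) (C : Set (Fin n → ZMod q)) : Prop :=
  ∃ p : StarPattern q n, {i | p i ≠ none}.ncard = m ∧ C = p.cube

/-- Component `i` is fixed in the set `C` of vectors. -/
def IsFixedIn {q n : ℕ} (i : Fin n) (C : Set (Fin n → ZMod q)) : Prop :=
  ∃ a : ZMod q, ∀ x ∈ C, x i = a

/-- `P` is an (unordered) partition of `(ZMod q)^n` into `q ^ m` subcubes of codimension `m`. -/
structure IsSubcubePartition (q n m : ℕ) (P : Set (Set (Fin n → ZMod q))) : Prop where
  isPartition : Setoid.IsPartition P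
  ncard_eq : P.ncard = q ^ m
  isSubcube : ∀ C ∈ P, IsSubcube q n m C

/-- An A-primitive partition into `q ^ m` subcubes of codimension `m`: every component is fixed
in at least one of the subcubes. -/
structure IsAPrimitivePartition (q n m : ℕ) (P : Set (Set (Fin n → ZMod q))) : Prop
    extends IsSubcubePartition q n m P where
  exists_fixed : ∀ i : Fin n, ∃ C ∈ P, IsFixedIn i C

/-- `cCoordStar q n m` is the number of A-primitive partitions of `(ZMod q)^n` into `q ^ m`
subcubes of codimension `m`. -/
noncomputable def cCoordStar (q n m : ℕ) : ℕ :=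
  {P : Set (Set (Fin n → ZMod q)) | IsAPrimitivePartition q n m P}.ncard

/-- The row indices of the matrix `M_{q,m}`. -/
def FractalRow (q : ℕ) : ℕ → Type
  | 0 => Unit
  | m + 1 => ZMod q × FractalRow q m

/-- The column indices of the matrix `M_{q,m}`; for `m + 1`, `none` is the leftmost column, and
`some (b, c)` is column `c` of the vertical stripe number `b`. -/
def FractalCol (q : ℕ) : ℕ → Type
  | 0 => Empty
  | m + 1 => Option (ZMod q × FractalCol q m)

/-- The star matrix `M_{q,m}`. The matrix `M_{q,0}` has one row and no columns. The matrix
`M_{q,m+1}` has `q` horizontal stripes: in stripe `a` the leftmost column is constantly `a`, it is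
followed by `q` vertical stripes, the one with number `a` being a copy of `M_{q,m}` and all
the others consisting of stars. -/
def fractalMatrix (q : ℕ) : (m : ℕ) → Matrix (FractalRow q m) (FractalCol q m) (Option (ZMod q))
  | 0 => fun _ c => nomatch c
  | m + 1 => fun r c =>
    match r, c with
    | (a, _), none => some a
    | (a, r'), some (b, c') => if a = b then fractalMatrix q m r' c' else none

/-- A star matrix is fractal (with parameters `q`, `m`) if it is obtained from `M_{q,m}` by
permuting rows and columns. -/
def IsFractal {q n : ℕ} (m : ℕ) (M : Matrix (Fin (q ^ m)) (Fin n) (Option (ZMod q))) : Prop :=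
  ∃ (e : FractalRow q m ≃ Fin (q ^ m)) (f : FractalCol q m ≃ Fin n),
    M = Matrix.reindex e f (fractalMatrix q m)

/-- `M` is a star matrix of `P`: its rows are the star patterns of the members of `P`, each
member corresponding to exactly one row. -/
def IsStarMatrixOf {q n k : ℕ} (M : Matrix (Fin k) (Fin n) (Option (ZMod q)))
    (P : Set (Set (Fin n → ZMod q))) : Prop :=
  Set.BijOn (fun r => StarPattern.cube (M r)) Set.univ P

/-! Put `d = q - 1`. The bound is a `q`-ary form of Tarsi's lemma on minimally unsatisfiable
formulas: a tiling that involves `n` components has at least `d * n + 1` subcubes (`Tiles.lt_card`).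
Let the deficiency of a family `B` of subcubes be `#B - d * #(varsOf p B)`. If it is maximal, Hall's
theorem (`exists_avoiding`) gives values for the components not fixed in `B` that avoid every
subcube outside `B`; so `B` alone covers the space and is the whole tiling (`Tiles.deficiency_lt`).
Comparison with the empty family gives the bound, and `q ^ m` subcubes leave room for at most `(q ^
m - 1) / (q - 1)` components.

In the case of equality, summing the bound over the slices at a component forces equality in each
slice and keeps the new components of different slices apart (`Tiles.tight_slices`). The tiling thus
behaves like a decision tree: a component with the most stars is a lowest node
(`Tiles.exists_leaf`), and slicing there leads by induction to a component fixed everywhere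
(`Tiles.exists_root`). Splitting at this root reproduces the recursion of `fractalMatrix`
(`Tiles.exists_fractal`).

Conversely, the fractal matrix is a tiling, and different numberings of its columns give different
partitions because its columns are rigid (`fractalMatrix_rigid`). Hence the factorial. -/

open Finset Function

/-- The vector `x` lies in the subcube with star pattern `s`. -/
def Matches {V K : Type*} (s : V → Option K) (x : V → K) : Prop :=
  ∀ i a, s i = some a → x i = a

/-- The subcubes with the star patterns `p k` tile the whole space: every vector lies in exactly
one of them. -/
def Tiles {ι V K : Type*} (p : ι → V → Option K) : Prop :=
  ∀ x : V → K, ∃! k, Matches (p k) x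

open scoped Classical in
/-- The components fixed by at least one of the patterns with index in `B`. -/
noncomputable def varsOf {ι V K : Type*} [Fintype V] (p : ι → V → Option K) (B : Finset ι) :
    Finset V :=
  {i | ∃ k ∈ B, p k i ≠ none}

open scoped Classical in
/-- The indices of the patterns that have a star in component `i`. -/
noncomputable def starRows {ι V K : Type*} [Fintype ι] (p : ι → V → Option K) (i : V) :
    Finset ι :=
  {k | p k i = none}

open scoped Classical in
/-- The indices of the patterns that have the value `a` in component `i`. -/
noncomputable def fixedRows {ι V K : Type*} [Fintype ι] (p : ι → V → Option K) (i : V) (a : K) :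
    Finset ι :=
  {k | p k i = some a}

open scoped Classical in
/-- The patterns of the intersections with the hyperplane `x i = a`, with component `i` freed. -/
noncomputable def sliceAt {ι V K : Type*} (p : ι → V → Option K) (i : V) (a : K) :
    {k // p k i = none ∨ p k i = some a} → V → Option K :=
  fun k => update (p k) i none

/-! ### Deficiency, the lower bound for the number of subcubes, and slices -/

section Tilings

variable {ι V K : Type} {p : ι → V → Option K}

theorem mem_varsOf [Fintype V] {B : Finset ι} {i : V} :
    i ∈ varsOf p B ↔ ∃ k ∈ B, p k i ≠ none := by
  simp [varsOf]

theorem mem_starRows [Fintype ι] {i : V} {k : ι} : k ∈ starRows p i ↔ p k i = none := by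
  simp [starRows]

theorem mem_fixedRows [Fintype ι] {i : V} {a : K} {k : ι} :
    k ∈ fixedRows p i a ↔ p k i = some a := by
  simp [fixedRows]

theorem exists_matches [Nonempty K] (s : V → Option K) : ∃ x, Matches s x := by
  refine ⟨fun i => (s i).getD (Classical.arbitrary K), fun i a h => ?_⟩
  simp [h]

theorem Tiles.eq_of_matches (h : Tiles p) {k l : ι} {x : V → K} (hk : Matches (p k) x)
    (hl : Matches (p l) x) : k = l :=
  (h x).unique hk hl

open scoped Classical in
/-- Hall's theorem yields a vector that avoids all subcubes with index in `A`, each of them in a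
component that belongs to `W`. -/
theorem exists_avoiding [Fintype V] [Fintype K] {d : ℕ} (hK : Fintype.card K = d + 1)
    (p : ι → V → Option K)
    (A : Finset ι) (W : Finset V)
    (hA : ∀ B ⊆ A, #B ≤ d * #(varsOf p B ∩ W)) :
    ∃ y : V → K, ∀ k ∈ A, ∃ i ∈ W, ∃ a, p k i = some a ∧ y i ≠ a := by
  -- With `d` copies of each component, a matching assigns at most `d` patterns to a component, so
  -- they forbid at most `d` of its `d + 1` values.
  let t : A → Finset (V × Fin d) := fun k => ({i ∈ W | p k i ≠ none} : Finset V) ×ˢ univ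
  have hall : ∀ s : Finset A, #s ≤ #(s.biUnion t) := by
    intro s
    have hs := hA (s.map (Embedding.subtype _)) (by
      intro k hk
      simp only [mem_map, Embedding.subtype_apply] at hk
      obtain ⟨k, -, rfl⟩ := hk
      exact k.2)
    rw [card_map] at hs
    have : s.biUnion t = (varsOf p (s.map (Embedding.subtype _)) ∩ W) ×ˢ univ := by
      ext ⟨i, j⟩
      simp only [t, mem_biUnion, mem_product, mem_filter, mem_univ, and_true, mem_inter,
        mem_varsOf, mem_map, Embedding.subtype_apply]
      constructor
      · rintro ⟨k, hk, hi, hki⟩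
        exact ⟨⟨k, ⟨k, hk, rfl⟩, hki⟩, hi⟩
      · rintro ⟨⟨_, ⟨k, hk, rfl⟩, hki⟩, hi⟩
        exact ⟨k, hk, hi, hki⟩
    rw [this, card_product, card_univ, Fintype.card_fin, mul_comm]
    exact hs
  obtain ⟨f, hf, hft⟩ := (all_card_le_biUnion_card_iff_exists_injective t).1 hall
  have hft' : ∀ k, (f k).1 ∈ W ∧ p k (f k).1 ≠ none := fun k => by
    simpa [t] using hft k
  have hy : ∀ i : V, ∃ y : K, ∀ k : A, (f k).1 = i → p k i ≠ some y := by
    intro i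
    by_contra! hcon
    choose g hg hpg using hcon
    have hinj : Injective fun y => (f (g y)).2 := by
      intro y z hyz
      have hgg : g y = g z := hf (Prod.ext ((hg y).trans (hg z).symm) hyz)
      have := hpg y
      rw [hgg, hpg z] at this
      exact (Option.some.inj this).symm
    have := Fintype.card_le_of_injective _ hinj
    simp [hK] at this
  choose y hy using hy
  refine ⟨y, fun k hk => ⟨(f ⟨k, hk⟩).1, (hft' ⟨k, hk⟩).1, ?_⟩⟩
  obtain ⟨a, ha⟩ := Option.ne_none_iff_exists'.1 (hft' ⟨k, hk⟩).2
  refine ⟨a, ha, fun hya => hy _ ⟨k, hk⟩ rfl ?_⟩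
  rw [hya]
  exact ha

open scoped Classical in
theorem varsOf_union [Fintype V] (p : ι → V → Option K) (B C : Finset ι) :
    varsOf p (B ∪ C) = varsOf p B ∪ varsOf p C := by
  ext i
  simp only [mem_varsOf, mem_union, or_and_right, exists_or]

open scoped Classical in
/-- In a tiling the deficiency `#B - d * #(varsOf p B)` is maximal only for the whole index set. -/
theorem Tiles.deficiency_lt [Fintype ι] [Fintype V] [Fintype K] {d : ℕ} (hK : Fintype.card K = d + 1)
    (hp : Tiles p)
    {B : Finset ι} (hB : B ≠ univ) :
    (#B : ℤ) - d * #(varsOf p B) < Fintype.card ι - d * #(varsOf p univ) := by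
  have : Nonempty K := Fintype.card_pos_iff.1 (by omega)
  let δ : Finset ι → ℤ := fun B => (#B : ℤ) - d * #(varsOf p B)
  have key : ∀ B, (∀ C, δ C ≤ δ B) → B = univ := by
    intro B hmax
    -- Maximality of `δ B` against `B ∪ C` is exactly Hall's condition for `C` on the components
    -- outside `varsOf p B`.
    obtain ⟨y, hy⟩ := exists_avoiding hK p Bᶜ (varsOf p B)ᶜ (by
      intro C hC
      have h1 := hmax (B ∪ C)
      have hd : Disjoint B C := disjoint_right.2 fun k hk => mem_compl.1 (hC hk)
      have h2 : #(varsOf p (B ∪ C)) = #(varsOf p B) + #(varsOf p C ∩ (varsOf p B)ᶜ) := by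
        rw [varsOf_union, ← card_union_of_disjoint]
        · congr 1
          ext i
          simp only [mem_union, mem_inter, mem_compl]
          tauto
        · exact disjoint_left.2 fun i hi hi' => mem_compl.1 (mem_inter.1 hi').2 hi
      simp only [δ, card_union_of_disjoint hd, h2] at h1
      push_cast at h1
      zify
      linarith)
    refine eq_univ_of_forall fun k₀ => ?_
    obtain ⟨x, hx⟩ := exists_matches (p k₀)
    -- The subcube of the mixed vector belongs to `B` by the choice of `y`. It ignores the
    -- components outside `varsOf p B`, so it contains `x` too.
    obtain ⟨k, hk, -⟩ := hp fun i => if i ∈ varsOf p B then x i else y i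
    have hkB : k ∈ B := by
      by_contra hkB
      obtain ⟨i, hi, a, ha, hya⟩ := hy k (mem_compl.2 hkB)
      have := hk i a ha
      simp only [if_neg (mem_compl.1 hi)] at this
      exact hya this
    have hkx : Matches (p k) x := by
      intro i a ha
      have hi : i ∈ varsOf p B := mem_varsOf.2 ⟨k, hkB, by simp [ha]⟩
      have := hk i a ha
      simpa only [if_pos hi] using this
    rwa [hp.eq_of_matches hx hkx]
  obtain ⟨M, -, hM⟩ := exists_max_image (univ : Finset (Finset ι)) δ univ_nonempty
  have hMu := key M fun C => hM C (mem_univ C)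
  subst hMu
  have hle := hM B (mem_univ B)
  have hne : δ B ≠ δ univ := fun h => hB (key B fun C => h ▸ hM C (mem_univ C))
  have := lt_of_le_of_ne hle hne
  simpa only [δ, card_univ] using this

theorem Tiles.nonempty [Nonempty K] (hp : Tiles p) : Nonempty ι :=
  ⟨(hp fun _ => Classical.arbitrary K).exists.choose⟩

/-- A tiling that involves `n` components consists of at least `n * (|K| - 1) + 1` subcubes. -/
theorem Tiles.lt_card [Fintype ι] [Fintype V] [Fintype K] {d : ℕ} (hK : Fintype.card K = d + 1)
    (hp : Tiles p) :
    d * #(varsOf p univ) + 1 ≤ Fintype.card ι := by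
  have : Nonempty K := Fintype.card_pos_iff.1 (by omega)
  have := hp.nonempty
  have h := hp.deficiency_lt hK (B := ∅) (by
    rw [ne_comm, ← nonempty_iff_ne_empty]
    exact univ_nonempty)
  have h0 : varsOf p ∅ = ∅ := by ext i; simp [mem_varsOf]
  rw [h0] at h
  simp only [card_empty] at h
  push_cast at h
  zify
  linarith

/-- The whole tiling has deficiency 1 here, so a proper subfamily has deficiency at most 0. -/
theorem Tiles.card_le_of_ne_univ [Fintype ι] [Fintype V] [Fintype K] {d : ℕ} (hK : Fintype.card K = d + 1)
    (hp : Tiles p)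
    (ht : Fintype.card ι = d * #(varsOf p univ) + 1) {B : Finset ι} (hB : B ≠ univ) :
    #B ≤ d * #(varsOf p B) := by
  have h := hp.deficiency_lt hK hB
  rw [ht] at h
  push_cast at h
  zify
  linarith

open scoped Classical in
-- A vector lies in a sliced subcube exactly when the vector with component `i` reset to `a` lies in
-- the original one.
theorem Tiles.tiles_sliceAt (hp : Tiles p) (i : V) (a : K) : Tiles (sliceAt p i a) := by
  intro x
  have hiff : ∀ k : {k // p k i = none ∨ p k i = some a},
      Matches (sliceAt p i a k) x ↔ Matches (p k) (update x i a) := by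
    rintro ⟨k, hk⟩
    simp only [Matches, sliceAt]
    constructor
    · intro h j b hb
      by_cases hj : j = i
      · subst hj
        rcases hk with hk | hk
        · simp [hk] at hb
        · rw [hk] at hb
          simpa using Option.some.inj hb
      · have := h j b (by simpa [hj] using hb)
        simpa [hj] using this
    · intro h j b hb
      by_cases hj : j = i
      · subst hj
        simp at hb
      · have := h j b (by simpa [hj] using hb)
        simpa [hj] using this
  obtain ⟨k, hk, huniq⟩ := hp (update x i a)
  have hki : p k i = none ∨ p k i = some a := by
    rcases h : p k i with _ | b
    · exact Or.inl rfl
    · have := hk i b h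
      simp only [update_self] at this
      exact Or.inr (by rw [this])
  refine ⟨⟨k, hki⟩, (hiff ⟨k, hki⟩).2 hk, fun l hl => Subtype.ext (huniq l ((hiff l).1 hl))⟩

open scoped Classical in
/-- The components other than `i` that are fixed in a subcube with value `a` in component `i`, but
in no subcube with a star there. -/
noncomputable def newVars [Fintype ι] [Fintype V] (p : ι → V → Option K) (i : V) (a : K) :
    Finset V :=
  (varsOf p (fixedRows p i a)).erase i \ varsOf p (starRows p i)

theorem mem_newVars [Fintype ι] [Fintype V] {i j : V} {a : K} : j ∈ newVars p i a ↔
    j ≠ i ∧ (∃ k, p k i = some a ∧ p k j ≠ none) ∧ ∀ k, p k i = none → p k j = none := by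
  simp only [newVars, mem_sdiff, mem_erase, mem_varsOf, mem_fixedRows, mem_starRows, not_exists,
    not_and, not_not, and_assoc]

open scoped Classical in
theorem card_sliceAt_index [Fintype ι] (p : ι → V → Option K) (i : V) (a : K)
    [Fintype {k // p k i = none ∨ p k i = some a}] :
    Fintype.card {k // p k i = none ∨ p k i = some a} =
      #(starRows p i) + #(fixedRows p i a) := by
  rw [Fintype.card_subtype, filter_or, card_union_of_disjoint]
  · rfl
  · rw [disjoint_filter]
    intro k _ h
    simp [h]

open scoped Classical in
theorem card_varsOf_sliceAt [Fintype ι] [Fintype V] (p : ι → V → Option K) (i : V) (a : K)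
    [Fintype {k // p k i = none ∨ p k i = some a}] :
    #(varsOf (sliceAt p i a) univ) = #(varsOf p (starRows p i)) + #(newVars p i a) := by
  rw [← card_union_of_disjoint]
  · congr 1
    ext j
    simp only [mem_varsOf, mem_univ, true_and, mem_union, mem_newVars, Subtype.exists,
      mem_starRows, sliceAt]
    by_cases hj : j = i
    · subst hj
      simp
    · simp only [update_of_ne hj]
      constructor
      · rintro ⟨k, hk | hk, hkj⟩
        · exact Or.inl ⟨k, hk, hkj⟩
        · by_cases h : ∃ k, p k i = none ∧ p k j ≠ none
          · exact Or.inl h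
          · push Not at h
            exact Or.inr ⟨hj, ⟨k, hk, hkj⟩, h⟩
      · rintro (⟨k, hk, hkj⟩ | ⟨-, ⟨k, hk, hkj⟩, -⟩)
        · exact ⟨k, Or.inl hk, hkj⟩
        · exact ⟨k, Or.inr hk, hkj⟩
  · rw [disjoint_left]
    intro j hj hj'
    obtain ⟨k, hk, hkj⟩ := mem_varsOf.1 hj
    exact hkj ((mem_newVars.1 hj').2.2 k (mem_starRows.1 hk))

theorem card_eq_starRows_add [Fintype ι] [Fintype K] (p : ι → V → Option K) (i : V) :
    Fintype.card ι = #(starRows p i) + ∑ a, #(fixedRows p i a) := by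
  classical
  rw [← card_univ, card_eq_sum_card_fiberwise (f := fun k => p k i) (t := univ) (by simp),
    Fintype.sum_option]
  rfl

open scoped Classical in
theorem varsOf_univ_eq [Fintype ι] [Fintype V] [Fintype K] (p : ι → V → Option K)
    {i : V} (hi : i ∈ varsOf p univ) :
    #(varsOf p univ) = 1 + #(varsOf p (starRows p i)) +
      #((univ : Finset K).biUnion (newVars p i)) := by
  have h1 : (varsOf p univ).erase i =
      varsOf p (starRows p i) ∪ (univ : Finset K).biUnion (newVars p i) := by
    ext j
    simp only [mem_erase, mem_union, mem_biUnion, mem_varsOf, mem_univ, true_and, mem_starRows,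
      mem_newVars]
    constructor
    · rintro ⟨hj, k, hk⟩
      by_cases h : ∃ k, p k i = none ∧ p k j ≠ none
      · exact Or.inl h
      · push Not at h
        right
        rcases hki : p k i with _ | a
        · exact absurd (h k hki) hk
        · exact ⟨a, hj, ⟨k, hki, hk⟩, h⟩
    · rintro (⟨k, hk, hkj⟩ | ⟨a, hj, ⟨k, hk, hkj⟩, -⟩)
      · exact ⟨fun h => hkj (h ▸ hk), k, hkj⟩
      · exact ⟨hj, k, hkj⟩
  have h2 := card_erase_add_one hi
  rw [h1, card_union_of_disjoint] at h2
  · omega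
  · rw [disjoint_left]
    intro j hj hj'
    obtain ⟨k, hk, hkj⟩ := mem_varsOf.1 hj
    obtain ⟨a, -, ha⟩ := mem_biUnion.1 hj'
    exact hkj ((mem_newVars.1 ha).2.2 k (mem_starRows.1 hk))

end Tilings

/-! ### Tilings that attain the bound -/

section Tight

variable {ι V K : Type} {p : ι → V → Option K}

open scoped Classical in
-- An element of two of the sets could be removed from one of them without changing the union, which
-- would make the sum too small.
theorem eq_of_mem_of_sum_card_le_card_biUnion {α β : Type*} [Fintype α] {U : α → Finset β}
    (h : ∑ a, #(U a) ≤ #(univ.biUnion U)) {a b : α} {j : β} (ha : j ∈ U a)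
    (hb : j ∈ U b) : a = b := by
  by_contra hab
  have hsub : univ.biUnion U ⊆ univ.biUnion (update U a ((U a).erase j)) := by
    intro x hx
    obtain ⟨c, -, hc⟩ := mem_biUnion.1 hx
    rw [mem_biUnion]
    by_cases hca : c = a
    · subst hca
      by_cases hxj : x = j
      · subst hxj
        exact ⟨b, mem_univ _, by rwa [update_of_ne (Ne.symm hab)]⟩
      · exact ⟨c, mem_univ _, by simp [hxj, hc]⟩
    · exact ⟨c, mem_univ _, by rwa [update_of_ne hca]⟩
  have h1 := h.trans ((card_le_card hsub).trans card_biUnion_le)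
  refine h1.not_gt (sum_lt_sum (fun c _ => ?_) ⟨a, mem_univ _, ?_⟩)
  · by_cases hca : c = a
    · subst hca
      simpa using card_le_card (erase_subset j (U c))
    · rw [update_of_ne hca]
  · simpa using card_erase_lt_of_mem ha

variable [Fintype ι] [Fintype V] [Fintype K] {d : ℕ}

/-- In a tiling with the least possible number of subcubes all the slices at a component are again
such tilings, and the new components of different slices are different. -/
theorem Tiles.tight_slices (hK : Fintype.card K = d + 1) (hd : 0 < d) (hp : Tiles p)
    (ht : Fintype.card ι = d * #(varsOf p univ) + 1) {i : V} (hi : i ∈ varsOf p univ) :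
    #(starRows p i) = d * #(varsOf p (starRows p i)) ∧
      (∀ a, #(fixedRows p i a) = d * #(newVars p i a) + 1) ∧
      ∀ a b j, a ≠ b → j ∈ newVars p i a → j ∉ newVars p i b := by
  classical
  have hS : #(starRows p i) ≤ d * #(varsOf p (starRows p i)) := by
    refine hp.card_le_of_ne_univ hK ht fun h => ?_
    obtain ⟨k, -, hk⟩ := mem_varsOf.1 hi
    exact hk (mem_starRows.1 (h ▸ mem_univ k))
  have hA : ∀ a, d * (#(varsOf p (starRows p i)) + #(newVars p i a)) + 1 ≤
      #(starRows p i) + #(fixedRows p i a) := fun a => by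
    have := (hp.tiles_sliceAt i a).lt_card hK
    rwa [card_sliceAt_index, card_varsOf_sliceAt] at this
  have hsum := card_eq_starRows_add p i
  have hvars := varsOf_univ_eq p hi
  have hU : #((univ : Finset K).biUnion (newVars p i)) ≤ ∑ a, #(newVars p i a) :=
    card_biUnion_le
  have hsumA := sum_le_sum fun a (_ : a ∈ (univ : Finset K)) => hA a
  simp only [sum_add_distrib, ← mul_sum, sum_const, card_univ, hK, smul_eq_mul] at hsumA
  rw [ht, hvars] at hsum
  set s := #(starRows p i)
  set v := #(varsOf p (starRows p i))
  set w := #((univ : Finset K).biUnion (newVars p i))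
  set u := ∑ a, #(newVars p i a) with hu
  set A := ∑ a, #(fixedRows p i a) with hAdef
  -- Eliminating `A` from `hsum` and `hsumA` leaves `d * (d * v) + d * u ≤ d * s + d * w`. As `s ≤ d
  -- * v` and `w ≤ u`, both are equalities.
  have hs : s = d * v := by
    refine le_antisymm hS (Nat.le_of_mul_le_mul_left ?_ hd)
    nlinarith
  have huw : u ≤ w := by
    refine Nat.le_of_mul_le_mul_left ?_ hd
    nlinarith
  have hA' : ∀ a, d * #(newVars p i a) + 1 ≤ #(fixedRows p i a) := fun a => by
    have := hA a
    rw [mul_add] at this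
    omega
  have hall : ∀ a ∈ (univ : Finset K), d * #(newVars p i a) + 1 = #(fixedRows p i a) := by
    refine (sum_eq_sum_iff_of_le fun a _ => hA' a).1 ?_
    simp only [sum_add_distrib, ← mul_sum, sum_const, card_univ, hK, smul_eq_mul]
    rw [← hu, ← hAdef, le_antisymm huw hU]
    nlinarith
  exact ⟨hs, fun a => (hall a (mem_univ a)).symm,
    fun a b j hab ha hb =>
    hab (eq_of_mem_of_sum_card_le_card_biUnion huw ha hb)⟩

/-- A tight tiling has a component without new components: a lowest one of the decision tree. -/
theorem Tiles.exists_leaf (hK : Fintype.card K = d + 1) (hd : 0 < d) (hp : Tiles p)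
    (ht : Fintype.card ι = d * #(varsOf p univ) + 1) (hne : (varsOf p univ).Nonempty) :
    ∃ i ∈ varsOf p univ, ∀ a, newVars p i a = ∅ := by
  have : Nontrivial K := Fintype.one_lt_card_iff_nontrivial.1 (by omega)
  -- A component `j` new at `i` would have a star wherever `i` has one, and also in the rows with
  -- another value `b` at `i`, contradicting maximality.
  obtain ⟨i, hi, hmax⟩ := exists_max_image _ (fun i => #(starRows p i)) hne
  refine ⟨i, hi, fun a => eq_empty_of_forall_notMem fun j hj => ?_⟩
  obtain ⟨-, hcard, hdisj⟩ := hp.tight_slices hK hd ht hi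
  obtain ⟨hji, ⟨k, -, hkj⟩, hstar⟩ := mem_newVars.1 hj
  obtain ⟨b, hb⟩ := exists_ne a
  have hbj : ∀ l, p l i = some b → p l j = none := by
    intro l hl
    by_contra hlj
    exact hdisj a b j hb.symm hj (mem_newVars.2 ⟨hji, ⟨l, hl, hlj⟩, hstar⟩)
  obtain ⟨l, hl⟩ : (fixedRows p i b).Nonempty := card_pos.1 (by rw [hcard]; omega)
  rw [mem_fixedRows] at hl
  refine (hmax j (mem_varsOf.2 ⟨k, mem_univ k, hkj⟩)).not_gt (card_lt_card ?_)
  refine (ssubset_iff_of_subset fun l hl => ?_).2 ⟨l, ?_, ?_⟩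
  · exact mem_starRows.2 (hstar l (mem_starRows.1 hl))
  · exact mem_starRows.2 (hbj l hl)
  · simp [mem_starRows, hl]

/-- In a tight tiling some component is fixed in all subcubes. -/
theorem Tiles.exists_root (hK : Fintype.card K = d + 1) (hd : 0 < d) (hp : Tiles p)
    (ht : Fintype.card ι = d * #(varsOf p univ) + 1) (hne : (varsOf p univ).Nonempty) :
    ∃ r, ∀ k, p k r ≠ none := by
  classical
  have : Nontrivial K := Fintype.one_lt_card_iff_nontrivial.1 (by omega)
  obtain ⟨n, hn⟩ : ∃ n, #(varsOf p univ) = n := ⟨_, rfl⟩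
  induction n generalizing ι with
  | zero => exact absurd (card_eq_zero.1 hn) hne.ne_empty
  | succ n ih =>
    obtain ⟨i, hi, hnew⟩ := hp.exists_leaf hK hd ht hne
    obtain ⟨hS, hA, -⟩ := hp.tight_slices hK hd ht hi
    have hv := varsOf_univ_eq p hi
    -- At a leaf each value occurs in exactly one row.
    simp only [hnew, card_empty, mul_zero, zero_add] at hA
    have hbi : (univ : Finset K).biUnion (newVars p i) = ∅ := by
      ext j
      simp [hnew]
    rw [hbi, card_empty, hn] at hv
    rcases Nat.eq_zero_or_pos n with rfl | hpos
    · refine ⟨i, fun k hk => ?_⟩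
      have h0 : #(starRows p i) = 0 := by
        rw [hS, show #(varsOf p (starRows p i)) = 0 by omega, mul_zero]
      exact notMem_empty k (card_eq_zero.1 h0 ▸ mem_starRows.2 hk)
    · obtain ⟨a₀⟩ : Nonempty K := inferInstance
      have hcv : #(varsOf (sliceAt p i a₀) univ) = n := by
        rw [card_varsOf_sliceAt, hnew, card_empty]
        omega
      obtain ⟨r, hr⟩ := ih (hp.tiles_sliceAt i a₀)
        (by rw [card_sliceAt_index, hA, hS, hcv, show #(varsOf p (starRows p i)) = n by omega])
        (card_pos.1 (by omega)) hcv
      have hri : r ≠ i := by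
        rintro rfl
        obtain ⟨k⟩ := (hp.tiles_sliceAt r a₀).nonempty
        exact hr k (by simp [sliceAt])
      have hr' : ∀ k, p k i = none ∨ p k i = some a₀ → p k r ≠ none := fun k hk => by
        simpa [sliceAt, hri] using hr ⟨k, hk⟩
      obtain ⟨l, hl⟩ := card_eq_one.1 (hA a₀)
      have hli : p l i = some a₀ := mem_fixedRows.1 (hl ▸ mem_singleton_self l)
      obtain ⟨b, hb⟩ := Option.ne_none_iff_exists'.1 (hr' l (Or.inr hli))
      obtain ⟨c, hc⟩ := exists_ne b
      -- Suppose row `k` has a star at `r`. Take a vector of its subcube with value `c ≠ b` at `r`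
      -- and move component `i` to `a₀`. The new vector is not in subcube `l`, so its subcube has a
      -- star at `i`, contains the old vector too and is that of `k`; but such rows are fixed at
      -- `r`.
      refine ⟨r, fun k hk => ?_⟩
      obtain ⟨x, hx⟩ := exists_matches (p k)
      have hxc : Matches (p k) (update x r c) := by
        intro j e hj
        have hjr : j ≠ r := by
          rintro rfl
          simp [hk] at hj
        rw [update_of_ne hjr]
        exact hx j e hj
      obtain ⟨t, htm, -⟩ := hp (update (update x r c) i a₀)
      rcases hti : p t i with _ | e
      · have htx : Matches (p t) (update x r c) := by
          intro j e hj
          have hji : j ≠ i := by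
            rintro rfl
            simp [hti] at hj
          have := htm j e hj
          rwa [update_of_ne hji] at this
        have := hp.eq_of_matches hxc htx
        subst this
        exact hr' k (Or.inl hti) hk
      · have he := htm i e hti
        rw [update_self] at he
        subst he
        have : t = l := mem_singleton.1 (hl ▸ mem_fixedRows.2 hti)
        subst this
        have := htm r b hb
        rw [update_of_ne hri, update_self] at this
        exact hc this

open scoped Classical in
theorem card_matches (s : V → Option K) :
    #{x : V → K | Matches s x} = Fintype.card K ^ #{i | s i = none} := by
  have : ({x : V → K | Matches s x} : Finset (V → K)) =
      Fintype.piFinset fun i =>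
        if s i = none then univ else (univ : Finset K).filter (s i = some ·) := by
    ext x
    rw [mem_filter, Fintype.mem_piFinset, and_iff_right (mem_univ x)]
    refine forall_congr' fun i => ?_
    rcases s i with _ | a
    · simp
    · simp [eq_comm]
  rw [this, Fintype.card_piFinset, ← prod_const, prod_filter]
  refine prod_congr rfl fun i _ => ?_
  rcases s i with _ | a
  · simp
  · simp [filter_eq]

open scoped Classical in
/-- A tiling by subcubes of codimension `m` consists of `|K| ^ m` subcubes. -/
theorem Tiles.card_eq_pow [Nonempty K] (hp : Tiles p) {m : ℕ}
    (hm : ∀ k, #{i | p k i ≠ none} = m) : Fintype.card ι = Fintype.card K ^ m := by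
  obtain ⟨k₀⟩ := hp.nonempty
  have hstar : ∀ k, #{i | p k i = none} + m = Fintype.card V := fun k => by
    rw [← hm k, card_filter_add_card_filter_not, card_univ]
  choose g hg hguniq using hp
  -- Volume count: the subcubes have equal size and partition the space.
  have h1 := card_eq_sum_card_fiberwise (f := g) (s := univ) (t := univ) (by simp)
  have h2 : ∀ k, #{x | g x = k} = Fintype.card K ^ #{i | p k₀ i = none} := by
    intro k
    have : #{i | p k₀ i = none} = #{i | p k i = none} := by
      have := hstar k
      have := hstar k₀
      omega
    rw [this, ← card_matches]
    congr 1
    ext x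
    simp only [mem_filter, mem_univ, true_and]
    exact ⟨fun h => h ▸ hg x, fun h => (hguniq x k h).symm⟩
  simp only [h2, sum_const, card_univ, smul_eq_mul, Fintype.card_fun] at h1
  rw [← hstar k₀, pow_add, mul_comm] at h1
  exact (Nat.eq_of_mul_eq_mul_right (pow_pos Fintype.card_pos _) h1).symm

end Tight

/-! ### Fractal matrices: tiling, rigidity and characterization -/

section Fractal

variable {q : ℕ}

noncomputable instance fractalRowFintype (q : ℕ) [NeZero q] : ∀ m, Fintype (FractalRow q m)
  | 0 => inferInstanceAs (Fintype Unit)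
  | m + 1 =>
    have := fractalRowFintype q m
    inferInstanceAs (Fintype (ZMod q × FractalRow q m))

noncomputable instance fractalColFintype (q : ℕ) [NeZero q] : ∀ m, Fintype (FractalCol q m)
  | 0 => inferInstanceAs (Fintype Empty)
  | m + 1 =>
    have := fractalColFintype q m
    inferInstanceAs (Fintype (Option (ZMod q × FractalCol q m)))

theorem fractalMatrix_none {m : ℕ} (a : ZMod q) (r : FractalRow q m) :
    fractalMatrix q (m + 1) (a, r) none = some a :=
  rfl

theorem fractalMatrix_some {m : ℕ} (a b : ZMod q) (r : FractalRow q m) (c : FractalCol q m) :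
    fractalMatrix q (m + 1) (a, r) (some (b, c)) =
      if a = b then fractalMatrix q m r c else none :=
  rfl

theorem card_fractalRow [NeZero q] (m : ℕ) : Fintype.card (FractalRow q m) = q ^ m := by
  induction m with
  | zero => exact Fintype.card_unit
  | succ m ih =>
    refine (Fintype.card_prod (ZMod q) (FractalRow q m)).trans ?_
    rw [ih, ZMod.card, pow_succ']

theorem card_fractalCol {d : ℕ} (hq : q = d + 1) [NeZero q] (m : ℕ) :
    d * Fintype.card (FractalCol q m) + 1 = q ^ m := by
  induction m with
  | zero =>
    have : Fintype.card (FractalCol q 0) = 0 := Fintype.card_empty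
    simp [this]
  | succ m ih =>
    have : Fintype.card (FractalCol q (m + 1)) = q * Fintype.card (FractalCol q m) + 1 := by
      refine (Fintype.card_option (α := ZMod q × FractalCol q m)).trans ?_
      rw [Fintype.card_prod, ZMod.card]
    rw [this, pow_succ', ← ih, mul_add, mul_add, mul_left_comm, mul_one, mul_one, add_assoc,
      ← hq]

theorem tiles_fractalMatrix (q m : ℕ) : Tiles (fractalMatrix q m) := by
  induction m with
  | zero => exact fun x => ⟨(), (fun i => nomatch i), fun _ _ => rfl⟩
  | succ m ih =>
    intro x
    obtain ⟨r, hr, huniq⟩ := ih fun c => x (some (x none, c))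
    refine ⟨(x none, r), ?_, ?_⟩
    · rintro (_ | ⟨b, c⟩) a h
      · exact Option.some.inj h
      · rw [fractalMatrix_some] at h
        split_ifs at h with hb
        subst hb
        exact hr c a h
    · rintro ⟨a, s⟩ hs
      obtain rfl : x none = a := hs none a rfl
      rw [huniq s fun c b h => hs (some (x none, c)) b (by rw [fractalMatrix_some, if_pos rfl, h])]

open scoped Classical in
theorem card_fixed_fractalMatrix [NeZero q] (m : ℕ) (r : FractalRow q m) :
    #{c | fractalMatrix q m r c ≠ none} = m := by
  induction m with
  | zero => exact card_eq_zero.2 (eq_empty_of_forall_notMem fun c => nomatch c)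
  | succ m ih =>
    obtain ⟨a, r⟩ := r
    have hblock : ∀ c, (if fractalMatrix q (m + 1) (a, r) (some (a, c)) ≠ none then 1 else 0) =
        if fractalMatrix q m r c ≠ none then 1 else 0 := fun c => by
      rw [fractalMatrix_some, if_pos rfl]
    have hsum : ∑ x : ZMod q × FractalCol q m,
        (if fractalMatrix q (m + 1) (a, r) (some x) ≠ none then 1 else 0) = m := by
      rw [Fintype.sum_prod_type, Fintype.sum_eq_single a]
      · rw [sum_congr rfl fun c _ => hblock c, ← card_filter, ih]
      · intro b hb
        refine sum_eq_zero fun c _ => if_neg ?_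
        rw [fractalMatrix_some, if_neg hb.symm, not_not]
    rw [card_filter]
    refine (Fintype.sum_option (α := ZMod q × FractalCol q m) fun c =>
      if fractalMatrix q (m + 1) (a, r) c ≠ none then 1 else 0).trans ?_
    exact (congrArg₂ (· + ·) (if_pos (Option.some_ne_none _)) hsum).trans (add_comm _ _)

theorem nonempty_fractalRow (q m : ℕ) : Nonempty (FractalRow q m) :=
  (tiles_fractalMatrix q m).nonempty

theorem exists_fractalMatrix_ne_none (m : ℕ) (c : FractalCol q m) :
    ∃ r, fractalMatrix q m r c ≠ none := by
  induction m with
  | zero => exact nomatch c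
  | succ m ih =>
    rcases c with _ | ⟨b, c⟩
    · obtain ⟨r⟩ := nonempty_fractalRow q m
      exact ⟨((0 : ZMod q), r), Option.some_ne_none _⟩
    · obtain ⟨r, hr⟩ := ih c
      exact ⟨(b, r), by rwa [fractalMatrix_some, if_pos rfl]⟩

/-- Only the identical map of the columns of a fractal matrix permutes the rows. -/
theorem fractalMatrix_rigid [Nontrivial (ZMod q)] (m : ℕ) (σ : FractalCol q m → FractalCol q m)
    (h : ∀ r, ∃ r', ∀ c, fractalMatrix q m r (σ c) = fractalMatrix q m r' c)
    (c : FractalCol q m) : σ c = c := by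
  induction m with
  | zero => exact nomatch c
  | succ m ih =>
    -- The leftmost column is the only one without stars.
    have hnone : σ none = none := by
      rcases hσ : σ none with _ | ⟨b, c⟩
      · rfl
      · obtain ⟨a, ha⟩ := exists_ne b
        obtain ⟨r⟩ := nonempty_fractalRow q m
        obtain ⟨⟨a', r'⟩, h'⟩ := h (a, r)
        have := h' none
        rw [hσ, fractalMatrix_some, if_neg ha, fractalMatrix_none] at this
        exact absurd this.symm (Option.some_ne_none _)
    have hrow : ∀ a r, ∃ r', ∀ c,
        fractalMatrix q (m + 1) (a, r) (σ c) = fractalMatrix q (m + 1) (a, r') c := by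
      intro a r
      obtain ⟨⟨a', r'⟩, h'⟩ := h (a, r)
      have := h' none
      rw [hnone, fractalMatrix_none, fractalMatrix_none] at this
      cases this
      exact ⟨r', h'⟩
    -- Since `σ` fixes the leftmost column, rows stay in their stripe; and a column of block `b` has
    -- non-stars only in stripe `b`.
    have hblock : ∀ b c, ∃ c', σ (some (b, c)) = some (b, c') := by
      intro b c
      rcases hσ : σ (some (b, c)) with _ | ⟨b', c'⟩
      · obtain ⟨a, ha⟩ := exists_ne b
        obtain ⟨r⟩ := nonempty_fractalRow q m
        obtain ⟨r', h'⟩ := hrow a r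
        have := h' (some (b, c))
        rw [hσ, fractalMatrix_some, if_neg ha, fractalMatrix_none] at this
        exact absurd this (Option.some_ne_none _)
      · obtain ⟨r, hr⟩ := exists_fractalMatrix_ne_none m c'
        obtain ⟨r', h'⟩ := hrow b' r
        have := h' (some (b, c))
        rw [hσ, fractalMatrix_some, if_pos rfl, fractalMatrix_some] at this
        split_ifs at this with hb
        · exact ⟨c', by rw [hb]⟩
        · exact absurd this hr
    rcases c with _ | ⟨b, c⟩
    · exact hnone
    · choose τ hτ using hblock
      have := ih (τ b) (fun r => by
        obtain ⟨r', h'⟩ := hrow b r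
        refine ⟨r', fun c => ?_⟩
        have := h' (some (b, c))
        rwa [hτ, fractalMatrix_some, if_pos rfl, fractalMatrix_some, if_pos rfl] at this) c
      rw [hτ, this]

open scoped Classical in
/-- A tiling by subcubes of codimension `m` that involves the largest possible number of components
is given by a fractal matrix. -/
theorem Tiles.exists_fractal {ι V : Type} [Fintype ι] [Fintype V] {d : ℕ} (hq : q = d + 1)
    (hd : 0 < d) [NeZero q] {p : ι → V → Option (ZMod q)} (hp : Tiles p) {m : ℕ}
    (hm : ∀ k, #{i | p k i ≠ none} = m) (hn : d * #(varsOf p univ) + 1 = q ^ m) :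
    ∃ (e : FractalRow q m ≃ ι) (f : FractalCol q m → V), Injective f ∧
      (∀ j, j ∈ varsOf p univ ↔ ∃ c, f c = j) ∧
      ∀ r c, p (e r) (f c) = fractalMatrix q m r c := by
  have hK : Fintype.card (ZMod q) = d + 1 := by rw [ZMod.card, hq]
  -- Slices keep the index type `V` and merely free a component; this is why `f` is only required to
  -- be a bijection onto the components involved.
  induction m generalizing ι with
  | zero =>
    have hcard : Fintype.card ι = 1 := by rw [hp.card_eq_pow hm, pow_zero]
    refine ⟨Fintype.equivOfCardEq (by rw [hcard, card_fractalRow, pow_zero]), (fun c => nomatch c),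
      (fun c => nomatch c), fun j => ?_, fun _ c => nomatch c⟩
    have h0 : #(varsOf p univ) = 0 := by
      rw [pow_zero, Nat.add_eq_right] at hn
      exact (Nat.mul_eq_zero.1 hn).resolve_left hd.ne'
    rw [card_eq_zero.1 h0]
    exact iff_of_false (notMem_empty j) fun ⟨c, _⟩ => (nomatch c)
  | succ m ih =>
    have ht : Fintype.card ι = d * #(varsOf p univ) + 1 := by
      rw [hp.card_eq_pow hm, ZMod.card, hn]
    obtain ⟨k₀⟩ := hp.nonempty
    have hne : (varsOf p univ).Nonempty := by
      obtain ⟨i, hi⟩ := card_pos.1 (show 0 < #{i | p k₀ i ≠ none} by rw [hm]; omega)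
      exact ⟨i, mem_varsOf.2 ⟨k₀, mem_univ _, by simpa using hi⟩⟩
    obtain ⟨r, hr⟩ := hp.exists_root hK hd ht hne
    have hrv : r ∈ varsOf p univ := mem_varsOf.2 ⟨k₀, mem_univ _, hr k₀⟩
    obtain ⟨-, hcard, hdisj⟩ := hp.tight_slices hK hd ht hrv
    have hS : starRows p r = ∅ := eq_empty_of_forall_notMem fun k hk => hr k (mem_starRows.1 hk)
    have hval : ∀ a (k : {k // p k r = none ∨ p k r = some a}), p k r = some a :=
      fun a k => k.2.resolve_left (hr k)
    have hm' : ∀ a (k : {k // p k r = none ∨ p k r = some a}),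
        #{i | sliceAt p r a k i ≠ none} = m := by
      intro a k
      have : ({i | sliceAt p r a k i ≠ none} : Finset V) =
          ({i | p k i ≠ none} : Finset V).erase r := by
        ext i
        rw [mem_erase, mem_filter, mem_filter]
        by_cases hi : i = r
        · subst hi
          simp [sliceAt]
        · simp [sliceAt, hi]
      rw [this, card_erase_of_mem (by simp [hr]), hm, Nat.add_sub_cancel]
    have hvars : ∀ a, #(varsOf (sliceAt p r a) univ) = #(newVars p r a) := fun a => by
      have h0 : varsOf p ∅ = ∅ := by ext i; simp [mem_varsOf]
      rw [card_varsOf_sliceAt, hS, h0, card_empty, zero_add]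
    -- No row has a star at the root, so the slice at `a` consists of the rows with value `a`; it is
    -- tight, and by volume it has `q ^ m` rows.
    have hn' : ∀ a, d * #(varsOf (sliceAt p r a) univ) + 1 = q ^ m := fun a => by
      rw [hvars, ← hcard, ← zero_add #(fixedRows p r a), ← card_empty, ← hS, ← card_sliceAt_index,
        (hp.tiles_sliceAt r a).card_eq_pow (hm' a), ZMod.card]
    choose e f hf hfv hef using fun a => ih (hp.tiles_sliceAt r a) (hm' a) (hn' a)
    have hfr : ∀ a c, f a c ≠ r := by
      rintro a c h
      obtain ⟨k, -, hk⟩ := mem_varsOf.1 ((hfv a (f a c)).2 ⟨c, rfl⟩)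
      exact hk (by simp [sliceAt, h])
    have hfnew : ∀ a c, f a c ∈ newVars p r a := by
      intro a c
      obtain ⟨k, -, hk⟩ := mem_varsOf.1 ((hfv a (f a c)).2 ⟨c, rfl⟩)
      refine mem_newVars.2 ⟨hfr a c, ⟨k, hval a k, ?_⟩, fun k hk => absurd hk (hr k)⟩
      simpa [sliceAt, hfr a c] using hk
    let E : ZMod q × FractalRow q m → ι := fun x => (e x.1 x.2).1
    have hEr : ∀ x, p (E x) r = some x.1 := fun x => hval _ _
    have hE : Bijective E := by
      constructor
      · rintro ⟨a, s⟩ ⟨b, t⟩ h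
        have h1 := hEr (a, s)
        rw [h, hEr (b, t)] at h1
        obtain rfl : b = a := Option.some.inj h1
        exact congrArg (Prod.mk b) ((e b).injective (Subtype.ext h))
      · intro k
        obtain ⟨a, ha⟩ := Option.ne_none_iff_exists'.1 (hr k)
        exact ⟨(a, (e a).symm ⟨k, Or.inr ha⟩), by simp [E]⟩
    let F : Option (ZMod q × FractalCol q m) → V := fun c => c.elim r fun c => f c.1 c.2
    refine ⟨Equiv.ofBijective E hE, F, ?_, ?_, ?_⟩
    · rintro (_ | ⟨a, c⟩) (_ | ⟨b, c'⟩) h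
      · rfl
      · exact absurd h.symm (hfr b c')
      · exact absurd h (hfr a c)
      · have h' : f a c = f b c' := h
        have hab : a = b := by
          by_contra hab
          exact hdisj a b _ hab (hfnew a c) (h' ▸ hfnew b c')
        subst hab
        rw [hf a h']
    · intro j
      constructor
      · intro hj
        by_cases hjr : j = r
        · exact ⟨none, hjr.symm⟩
        · obtain ⟨k, -, hk⟩ := mem_varsOf.1 hj
          obtain ⟨a, ha⟩ := Option.ne_none_iff_exists'.1 (hr k)
          obtain ⟨c, hc⟩ := (hfv a j).1
            (mem_varsOf.2 ⟨⟨k, Or.inr ha⟩, mem_univ _, by simpa [sliceAt, hjr] using hk⟩)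
          exact ⟨some (a, c), hc⟩
      · rintro ⟨_ | ⟨a, c⟩, rfl⟩
        · exact hrv
        · obtain ⟨-, ⟨k, -, hk⟩, -⟩ := mem_newVars.1 (hfnew a c)
          exact mem_varsOf.2 ⟨k, mem_univ _, hk⟩
    · rintro ⟨a, s⟩ (_ | ⟨b, c⟩)
      · exact hEr (a, s)
      · rw [fractalMatrix_some]
        change p (e a s).1 (f b c) = _
        split_ifs with hab
        · subst hab
          rw [← hef a]
          simp [sliceAt, hfr]
        -- A non-star outside the diagonal blocks would make the same component new for two values.
        · by_contra hne
          refine hdisj b a _ (Ne.symm hab) (hfnew b c) (mem_newVars.2 ⟨hfr b c,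
            ⟨_, hval a (e a s), hne⟩, fun k hk => absurd hk (hr k)⟩)

end Fractal

/-! ### From star patterns to families of sets -/

section Partitions

variable {q n m : ℕ}

/-- A subcube is nonempty and a free component takes at least two values in it, so the set
determines which components are fixed. -/
theorem isFixedIn_cube [Nontrivial (ZMod q)] {p : StarPattern q n} {i : Fin n} :
    IsFixedIn i p.cube ↔ p i ≠ none := by
  constructor
  · rintro ⟨a, ha⟩ hi
    obtain ⟨x, hx⟩ := exists_matches (K := ZMod q) p
    obtain ⟨b, hb⟩ := exists_ne a
    have := ha (update x i b) (by
      intro j c hj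
      have hji : j ≠ i := by
        rintro rfl
        simp [hi] at hj
      rw [update_of_ne hji]
      exact hx j c hj)
    rw [update_self] at this
    exact hb this
  · intro h
    obtain ⟨a, ha⟩ := Option.ne_none_iff_exists'.1 h
    exact ⟨a, fun x hx => hx i a ha⟩

theorem StarPattern.cube_injective [Nontrivial (ZMod q)] :
    Injective (StarPattern.cube : StarPattern q n → _) := by
  have key : ∀ p s : StarPattern q n, p.cube = s.cube → ∀ i a, p i = some a → s i = some a := by
    intro p s h i a hi
    obtain ⟨b, hb⟩ := Option.ne_none_iff_exists'.1
      (isFixedIn_cube.1 (h ▸ ⟨a, fun x hx => hx i a hi⟩ : IsFixedIn i s.cube))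
    obtain ⟨x, hx⟩ := exists_matches (K := ZMod q) s
    have hxp : x ∈ p.cube := h ▸ hx
    rw [hb, ← hx i b hb, hxp i a hi]
  intro p s h
  funext i
  exact Option.ext fun a => ⟨key p s h i a, key s p h.symm i a⟩

open scoped Classical in
theorem IsAPrimitivePartition.exists_tiles [Nontrivial (ZMod q)]
    {P : Set (Set (Fin n → ZMod q))} [Fintype P] (hP : IsAPrimitivePartition q n m P) :
    ∃ p : P → StarPattern q n, (∀ C, C.1 = (p C).cube) ∧ Tiles p ∧
      (∀ C, #{i | p C i ≠ none} = m) ∧ varsOf p univ = univ := by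
  choose p hpm hpC using fun C : P => hP.isSubcube C C.2
  refine ⟨p, hpC, fun x => ?_, fun C => ?_, eq_univ_of_forall fun i => ?_⟩
  · obtain ⟨C, ⟨hC, hx⟩, huniq⟩ := hP.isPartition.2 x
    refine ⟨⟨C, hC⟩, ?_, fun D hD => Subtype.ext (huniq D ⟨D.2, ?_⟩)⟩
    · change x ∈ (p ⟨C, hC⟩).cube
      rw [← hpC]
      exact hx
    · rw [hpC]
      exact hD
  · rw [← hpm C, Set.ncard_eq_toFinset_card']
    simp
  · obtain ⟨C, hC, hi⟩ := hP.exists_fixed i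
    refine mem_varsOf.2 ⟨⟨C, hC⟩, mem_univ _, isFixedIn_cube.1 ?_⟩
    rwa [← hpC]

open scoped Classical in
theorem Tiles.isAPrimitivePartition [Nontrivial (ZMod q)] [NeZero q] {ι : Type} [Fintype ι]
    {p : ι → StarPattern q n} (hp : Tiles p) (hm : ∀ k, #{i | p k i ≠ none} = m)
    (hvars : ∀ i, ∃ k, p k i ≠ none) :
    IsAPrimitivePartition q n m (Set.range fun k => (p k).cube) := by
  have hinj : Injective fun k => (p k).cube := by
    intro k l h
    obtain ⟨x, hx⟩ := exists_matches (K := ZMod q) (p k)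
    have hl : x ∈ (p l).cube := (show (p k).cube = (p l).cube from h) ▸ hx
    exact hp.eq_of_matches hx hl
  refine ⟨⟨⟨?_, fun x => ?_⟩, ?_, ?_⟩, fun i => ?_⟩
  · rintro ⟨k, hk⟩
    obtain ⟨x, hx⟩ := exists_matches (K := ZMod q) (p k)
    exact Set.notMem_empty x (hk ▸ hx : x ∈ (∅ : Set _))
  · obtain ⟨k, hk, huniq⟩ := hp x
    refine ⟨(p k).cube, ⟨⟨k, rfl⟩, hk⟩, ?_⟩
    rintro _ ⟨⟨l, rfl⟩, hl⟩
    simp only [huniq l hl]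
  · rw [← Set.image_univ, Set.ncard_image_of_injective _ hinj, Set.ncard_univ,
      Nat.card_eq_fintype_card, hp.card_eq_pow hm, ZMod.card]
  · rintro _ ⟨k, rfl⟩
    refine ⟨p k, ?_, rfl⟩
    rw [← hm k, Set.ncard_eq_toFinset_card']
    simp
  · obtain ⟨k, hk⟩ := hvars i
    exact ⟨_, ⟨k, rfl⟩, isFixedIn_cube.2 hk⟩

/-- The family of subcubes given by the rows of `M_{q,m}` with columns numbered by `f`. -/
def fractalPartition (f : FractalCol q m ≃ Fin n) : Set (Set (Fin n → ZMod q)) :=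
  Set.range fun r => StarPattern.cube fun i => fractalMatrix q m r (f.symm i)

theorem isAPrimitivePartition_fractalPartition [Nontrivial (ZMod q)] [NeZero q]
    (f : FractalCol q m ≃ Fin n) : IsAPrimitivePartition q n m (fractalPartition f) := by
  classical
  refine Tiles.isAPrimitivePartition (fun x => ?_) (fun r => ?_) fun i =>
    exists_fractalMatrix_ne_none m _
  · obtain ⟨r, hr, huniq⟩ := tiles_fractalMatrix q m (x ∘ f)
    refine ⟨r, fun i a h => ?_, fun s hs => huniq s fun c a h => ?_⟩
    · simpa using hr (f.symm i) a h
    · exact hs (f c) a (by simpa using h)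
  · refine (card_equiv f.symm fun i => ?_).trans (card_fixed_fractalMatrix m r)
    simp

/-- If `f` and `g` give the same family, then `f.symm ∘ g` carries rows of the fractal matrix to
rows, so rigidity applies. -/
theorem fractalPartition_injective [Nontrivial (ZMod q)] :
    Injective (fractalPartition : (FractalCol q m ≃ Fin n) → _) := by
  intro f g h
  have hσ := fractalMatrix_rigid m (fun c => f.symm (g c)) fun r => by
    obtain ⟨r', hr'⟩ : StarPattern.cube (fun i => fractalMatrix q m r (f.symm i)) ∈
        fractalPartition g := h ▸ ⟨r, rfl⟩
    refine ⟨r', fun c => ?_⟩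
    have := congrFun (StarPattern.cube_injective hr') (g c)
    simpa using this.symm
  ext c : 1
  rw [← f.symm_apply_eq.1 (hσ c)]

theorem IsAPrimitivePartition.mul_lt_pow [Nontrivial (ZMod q)] [NeZero q] {d : ℕ}
    (hq : q = d + 1) {P : Set (Set (Fin n → ZMod q))} (hP : IsAPrimitivePartition q n m P) :
    d * n + 1 ≤ q ^ m := by
  classical
  have : Fintype P := Fintype.ofFinite P
  obtain ⟨p, -, hp, hm, hvars⟩ := hP.exists_tiles
  have := hp.lt_card (by rw [ZMod.card, hq])
  rwa [hvars, card_univ, Fintype.card_fin, hp.card_eq_pow hm, ZMod.card] at this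

theorem IsAPrimitivePartition.exists_eq_fractalPartition [Nontrivial (ZMod q)] [NeZero q] {d : ℕ}
    (hq : q = d + 1) (hd : 0 < d) {P : Set (Set (Fin n → ZMod q))}
    (hP : IsAPrimitivePartition q n m P) (hn : d * n + 1 = q ^ m) :
    ∃ f : FractalCol q m ≃ Fin n, P = fractalPartition f := by
  classical
  have : Fintype P := Fintype.ofFinite P
  obtain ⟨p, hpC, hp, hm, hvars⟩ := hP.exists_tiles
  obtain ⟨e, f, hf, hfv, hef⟩ := hp.exists_fractal hq hd hm
    (by rwa [hvars, card_univ, Fintype.card_fin])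
  have hfs : Surjective f := fun j => (hfv j).1 (hvars ▸ mem_univ j)
  refine ⟨Equiv.ofBijective f ⟨hf, hfs⟩, ?_⟩
  have hrow : ∀ r, (fun i => fractalMatrix q m r ((Equiv.ofBijective f ⟨hf, hfs⟩).symm i)) =
      p (e r) := by
    intro r
    funext i
    rw [← hef, Equiv.ofBijective_apply_symm_apply f ⟨hf, hfs⟩]
  have : fractalPartition (Equiv.ofBijective f ⟨hf, hfs⟩) = Set.range fun r => (e r).1 := by
    refine congrArg Set.range (funext fun r => ?_)
    rw [hrow, ← hpC]
  rw [this]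
  exact (e.surjective.range_comp Subtype.val).trans Subtype.range_coe |>.symm

/-- The order of the rows is lost in the family, so only the numbering of the columns remains. -/
theorem exists_isFractal_iff [Nontrivial (ZMod q)] [NeZero q] (P : Set (Set (Fin n → ZMod q))) :
    (∃ M : Matrix (Fin (q ^ m)) (Fin n) (Option (ZMod q)), IsFractal m M ∧ IsStarMatrixOf M P) ↔
      ∃ f : FractalCol q m ≃ Fin n, P = fractalPartition f := by
  constructor
  · rintro ⟨_, ⟨e, f, rfl⟩, hM⟩
    refine ⟨f, ?_⟩
    rw [← hM.image_eq, Set.image_univ]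
    exact e.symm.surjective.range_comp
      fun r => StarPattern.cube fun i => fractalMatrix q m r (f.symm i)
  · rintro ⟨f, rfl⟩
    let e : FractalRow q m ≃ Fin (q ^ m) :=
      Fintype.equivOfCardEq (by rw [card_fractalRow, Fintype.card_fin])
    refine ⟨_, ⟨e, f, rfl⟩, ?_⟩
    have hrange : (fun r => StarPattern.cube (Matrix.reindex e f (fractalMatrix q m) r)) ''
        Set.univ = fractalPartition f := by
      rw [Set.image_univ]
      exact e.symm.surjective.range_comp
        fun r => StarPattern.cube fun i => fractalMatrix q m r (f.symm i)
    refine ⟨fun r _ => hrange ▸ ⟨r, trivial, rfl⟩, ?_, hrange.ge⟩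
    intro r _ s _ h
    have h' := StarPattern.cube_injective h
    refine e.symm.injective ?_
    obtain ⟨x, hx⟩ := exists_matches (K := ZMod q) (fractalMatrix q m (e.symm r))
    refine (tiles_fractalMatrix q m).eq_of_matches hx fun c a hc => hx c a ?_
    have := congrFun h' (f c)
    simp only [Matrix.reindex_apply, Matrix.submatrix_apply, Equiv.symm_apply_apply] at this
    rw [this, hc]

end Partitions

theorem mainTheorem2 (q m : ℕ) (hq : 2 ≤ q) :
    IsLeast {N : ℕ | ∀ n > N, ¬ ∃ P, IsAPrimitivePartition q n m P} ((q ^ m - 1) / (q - 1)) ∧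
    IsGreatest {n : ℕ | ∃ P, IsAPrimitivePartition q n m P} ((q ^ m - 1) / (q - 1)) ∧
    cCoordStar q ((q ^ m - 1) / (q - 1)) m = ((q ^ m - 1) / (q - 1)).factorial ∧
    ∀ P : Set (Set (Fin ((q ^ m - 1) / (q - 1)) → ZMod q)),
      IsAPrimitivePartition q ((q ^ m - 1) / (q - 1)) m P ↔
        ∃ M : Matrix (Fin (q ^ m)) (Fin ((q ^ m - 1) / (q - 1))) (Option (ZMod q)),
          IsFractal m M ∧ IsStarMatrixOf M P := by
  obtain ⟨d, rfl⟩ : ∃ d, q = d + 1 := ⟨q - 1, by omega⟩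
  have hd : 0 < d := by omega
  have : Fact (1 < d + 1) := ⟨hq⟩
  have : NeZero (d + 1) := ⟨by omega⟩
  have hcard : Fintype.card (FractalCol (d + 1) m) = ((d + 1) ^ m - 1) / (d + 1 - 1) := by
    rw [← card_fractalCol rfl m, Nat.add_sub_cancel, Nat.add_sub_cancel,
      Nat.mul_div_cancel_left _ hd]
  -- The division is exact, because the quotient counts the columns of the fractal matrix.
  have hn : d * (((d + 1) ^ m - 1) / (d + 1 - 1)) + 1 = (d + 1) ^ m := by
    rw [← hcard, card_fractalCol rfl m]
  generalize ((d + 1) ^ m - 1) / (d + 1 - 1) = n at hcard hn ⊢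
  let f₀ : FractalCol (d + 1) m ≃ Fin n := Fintype.equivFinOfCardEq hcard
  have hex : ∃ P, IsAPrimitivePartition (d + 1) n m P :=
    ⟨_, isAPrimitivePartition_fractalPartition f₀⟩
  have hle : ∀ k, (∃ P, IsAPrimitivePartition (d + 1) k m P) → k ≤ n := by
    rintro k ⟨P, hP⟩
    have := hP.mul_lt_pow rfl
    rw [← hn] at this
    exact Nat.le_of_mul_le_mul_left (Nat.le_of_succ_le_succ this) hd
  have hiff : ∀ P : Set (Set (Fin n → ZMod (d + 1))), IsAPrimitivePartition (d + 1) n m P ↔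
      ∃ f : FractalCol (d + 1) m ≃ Fin n, P = fractalPartition f := fun P =>
    ⟨fun hP => hP.exists_eq_fractalPartition rfl hd hn, by
      rintro ⟨f, rfl⟩
      exact isAPrimitivePartition_fractalPartition f⟩
  refine ⟨⟨fun k hk hP => (hle k hP).not_gt hk, fun N hN => ?_⟩, ⟨hex, fun k hk => hle k hk⟩, ?_,
    fun P => (hiff P).trans (exists_isFractal_iff P).symm⟩
  · by_contra! h
    exact hN n h hex
  · classical
    have : {P : Set (Set (Fin n → ZMod (d + 1))) | IsAPrimitivePartition (d + 1) n m P} =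
        fractalPartition '' (Set.univ : Set (FractalCol (d + 1) m ≃ Fin n)) := by
      ext P
      rw [Set.mem_ofPred_eq, hiff, Set.image_univ, Set.mem_range]
      exact exists_congr fun f => eq_comm
    rw [cCoordStar, this, Set.ncard_image_of_injective _ fractalPartition_injective,
      Set.ncard_univ, Nat.card_eq_fintype_card, Fintype.card_equiv f₀, hcard]
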